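/- All sets are finite sets of natural numbers and all families are finite families of such sets. A family $F$ is union-closed if $A\cup B\in F$ for all $A,B\in F$. A family $F_c$ is an FC-family (Frankl-complete) if for every union-closed family $F\supseteq F_c$ there is an element $a\in\bigcup F_c$ that belongs to at least half of the members of $F$, i.e. $2\cdot|\{A\in F: a\in A\}|\ge |F|$. The number $\mathrm{FC}(k,n)$ is the least $m$ such that every family containing at least $m$ sets of size $k$ whose union has exactly $n$ elements is an FC-family; precisely, the least $m$ such that every family $F_c$ having a subfamily $G\subseteq F_c$ with $|G|\ge m$, all members of $G$ of size $k$, and $|\bigcup G|=n$, is an FC-family. Then $\mathrm{FC}(4,6)=7$. Moreover, for every $m\ge 2$, the statement "every family consisting of exactly $m$ four-element sets whose union has exactly six elements is an FC-family" holds if and only if $m\ge 7$. -/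

import Mathlib

/-- A finite family `Fc` of finite sets of natural numbers is an *FC-family* (Frankl-complete):
in every finite union-closed family `F ⊇ Fc`, some element of `⋃ Fc` belongs to at least half of
the members of `F`. (`SupClosed` for finite sets says that `A ∪ B ∈ F` for all `A, B ∈ F`.) -/
def IsFCFamily (Fc : Finset (Finset ℕ)) : Prop :=
  ∀ F : Finset (Finset ℕ), SupClosed (F : Set (Finset ℕ)) → Fc ⊆ F →
    ∃ a ∈ Fc.biUnion id, F.card ≤ 2 * (F.filter fun A => a ∈ A).card

/-- `m` is large enough to force the FC property: every family containing (at least) `m` sets of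
size `k` whose union has exactly `n` elements is an FC-family. -/
def ForcesFC (k n m : ℕ) : Prop :=
  ∀ Fc G : Finset (Finset ℕ), G ⊆ Fc → (∀ A ∈ G, A.card = k) → m ≤ G.card →
    (G.biUnion id).card = n → IsFCFamily Fc

/-- `m` is the number `FC(k, n)`: the least `m` such that every family containing `m` sets of
size `k` whose union has exactly `n` elements is an FC-family. -/
def IsFCNumber (k n m : ℕ) : Prop :=
  IsLeast {m' : ℕ | ForcesFC k n m'} m

/-! Upper bound: put nonnegative weights `w` on the six points of `U`. A union-closed `F` splits
into classes by `S \ U`. The traces on `U` of one class form a union-closed family `X`, also closed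
under unions with the given four-sets. If `2 w(S) - w(U)` has nonnegative sum over every such `X`,
adding up the classes shows that the weighted average frequency in `F` is at least one half, so some
point of `U` is frequent (`exists_card_le_of_check`). Seven of the given sets suffice. Up to
relabelling there are few septuples, and for each a branch and bound over all `X`, justified by
`search_sound`, confirms the inequality for explicit weights (`reducibleOrCheck_sublistsLen`).

Lower bound: the six four-sets containing `{4, 5}`, with their unions, are absorbing: uniting any of
them with a subset of `U` stays among them. They can thus be added to every section of a large
family whose other sets favour small traces. With suitable multiplicities all six points become rare
(`rare_counterexample`), which rules out any subfamily of these sets. -/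

/-! ### Families of subsets of a six-set as 768-bit numbers, with 12 bits per subset -/

/-- The number whose digit `b` in base `4096` is `f b`, for `b < n`. -/
def laneSum (f : ℕ → ℕ) : ℕ → ℕ
  | 0 => 0
  | n + 1 => Nat.add (laneSum f n) (Nat.shiftLeft (f n) (12 * n))

/-- All lanes `b < 64` with bit `i` of `b` equal to `0`. -/
def lanesWithout (i : ℕ) : ℕ := (2 ^ 768 - 1) / (2 ^ (12 * 2 ^ i) + 1)

/-- All lanes `b < 64` with bit `i` of `b` equal to `1`. -/
def lanesWith (i : ℕ) : ℕ := Nat.sub (2 ^ 768 - 1) (lanesWithout i)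

/-- Insert the element `i` into every member of the family `A`. -/
def insertBit (i A : ℕ) : ℕ :=
  Nat.lor (Nat.shiftLeft (Nat.land A (lanesWithout i)) (12 * 2 ^ i)) (Nat.land A (lanesWith i))

def bitAt (i S : ℕ) : ℕ := Nat.land (Nat.shiftRight S i) 1

def insertBitIf (i S A : ℕ) : ℕ := bif Nat.beq (bitAt i S) 1 then insertBit i A else A

/-- Unite every member of the family `A` with `S`. -/
def joinAll (S A : ℕ) : ℕ :=
  insertBitIf 5 S (insertBitIf 4 S (insertBitIf 3 S (insertBitIf 2 S (insertBitIf 1 S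
    (insertBitIf 0 S A)))))

def fullLane (S : ℕ) : ℕ := Nat.shiftLeft 4095 (12 * S)

/-- Branch and bound over the union-closed families `X` that contain the lanes of `A`, avoid those
of `E` and are closed under unions with the lanes of `G`: the total deficit of `X`, which is at most
`D`, never exceeds its total surplus, which is at least that of `A` as read off from `P`. -/
def search (P G : ℕ) : List (ℕ × ℕ) → ℕ → ℕ → ℕ → Bool
  | [], A, _, D => Nat.ble D (Nat.mod (Nat.land A P) 4095)
  | x :: L, A, E, D =>
    bif Nat.ble D (Nat.mod (Nat.land A P) 4095) then true
    else bif Nat.beq (Nat.land A (fullLane x.1)) 0 then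
      bif search P G L A (Nat.lor E (fullLane x.1)) (Nat.sub D x.2) then
        bif Nat.beq (Nat.land (Nat.lor A (joinAll x.1 (Nat.lor A G))) E) 0 then
          search P G L (Nat.lor A (joinAll x.1 (Nat.lor A G))) E D
        else true
      else false
    else search P G L A E D

def weight : List ℕ → ℕ → ℕ
  | [], _ => 0
  | a :: w, S => Nat.add (Nat.mul a (Nat.mod S 2)) (weight w (Nat.div S 2))

def surplus (w : List ℕ) (S : ℕ) : ℕ := Nat.sub (Nat.mul 2 (weight w S)) w.sum

def deficit (w : List ℕ) (S : ℕ) : ℕ := Nat.sub w.sum (Nat.mul 2 (weight w S))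

/-- Starting from the lane of the empty set makes the result contain `0`, so that joining a set `x`
with these lanes also yields `x` itself. -/
def closureLanes : List ℕ → ℕ
  | [] => 4095
  | g :: l => Nat.lor (closureLanes l) (joinAll g (closureLanes l))

/-- Ordered by cardinality: including a small set forces many of its unions, which prunes the search
early. -/
def smallCodes : List ℕ := [0, 1, 2, 4, 8, 16, 32, 3, 5, 6, 9, 10, 12, 17, 18, 20, 24, 33, 34, 36,
  40, 48, 7, 11, 13, 14, 19, 21, 22, 25, 26, 28, 35, 37, 38, 41, 42, 44, 49, 50, 52, 56, 15, 23,
  27, 29, 30, 39, 43, 45, 46, 51, 53, 54, 57, 58, 60, 31, 47, 55, 59, 61, 62, 63]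

/-- Test that the shares given by the weights `w` sum to a nonnegative number on every union-closed
family that is closed under unions with the members of `l`. -/
def check (w l : List ℕ) : Bool :=
  search (laneSum (surplus w) 64) (closureLanes l)
    ((smallCodes.map fun S => (S, deficit w S)).filter fun x => Nat.blt 0 x.2) 0 0
    ((smallCodes.map (deficit w)).sum)

/-! ### Correctness of the lane arithmetic -/

/-- Every nonzero bit of `A` lies in a lane belonging to `X`. -/
def LanesIn (A : ℕ) (X : Set ℕ) : Prop := ∀ p, A.testBit p = true → p / 12 ∈ X

theorem LanesIn.lor {A B : ℕ} {X : Set ℕ} (hA : LanesIn A X) (hB : LanesIn B X) :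
    LanesIn (Nat.lor A B) X := by
  intro p hp
  change (A ||| B).testBit p = true at hp
  rw [Nat.testBit_or, Bool.or_eq_true] at hp
  exact hp.elim (hA p) (hB p)

theorem lanesIn_zero (X : Set ℕ) : LanesIn 0 X := by
  intro p hp
  simp at hp

theorem testBit_fullLane {S p : ℕ} : (fullLane S).testBit p = true ↔ p / 12 = S := by
  change (4095 <<< (12 * S)).testBit p = true ↔ _
  rw [show 4095 = 2 ^ 12 - 1 by norm_num, Nat.testBit_shiftLeft, Nat.testBit_two_pow_sub_one]
  simp only [Bool.and_eq_true, decide_eq_true_eq]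
  omega

theorem lanesIn_fullLane {S : ℕ} {X : Set ℕ} (h : S ∈ X) : LanesIn (fullLane S) X := by
  intro p hp
  rwa [testBit_fullLane.1 hp]

theorem land_eq_zero_of_lanesIn {A E : ℕ} {X : Set ℕ} (hA : LanesIn A X) (hE : LanesIn E Xᶜ) :
    Nat.land A E = 0 := by
  refine Nat.eq_of_testBit_eq fun p => ?_
  rw [Nat.zero_testBit, Bool.eq_false_iff]
  intro hp
  change (A &&& E).testBit p = true at hp
  rw [Nat.testBit_and, Bool.and_eq_true] at hp
  exact hE p hp.2 (hA p hp.1)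

theorem testBit_lanesWithout {i p : ℕ} (hi : i < 6) (h : (lanesWithout i).testBit p = true) :
    p < 768 ∧ (p / 12).testBit i = false := by
  have hp : p < 768 := by
    by_contra hp
    have : lanesWithout i < 2 ^ p :=
      (Nat.div_le_self _ _).trans_lt (lt_of_lt_of_le (by norm_num)
        (Nat.pow_le_pow_right (by norm_num) (not_lt.1 hp)))
    rw [Nat.testBit_lt_two_pow this] at h
    exact Bool.noConfusion h
  have key : ∀ i < 6, ∀ p < 768, (lanesWithout i).testBit p = true →
      (p / 12).testBit i = false := by decide +kernel
  exact ⟨hp, key i hi p hp h⟩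

theorem testBit_lanesWith {i p : ℕ} (hi : i < 6) (h : (lanesWith i).testBit p = true) :
    p < 768 ∧ (p / 12).testBit i = true := by
  have hp : p < 768 := by
    by_contra hp
    have : lanesWith i < 2 ^ p :=
      (Nat.sub_le _ _).trans_lt (lt_of_lt_of_le (by norm_num)
        (Nat.pow_le_pow_right (by norm_num) (not_lt.1 hp)))
    rw [Nat.testBit_lt_two_pow this] at h
    exact Bool.noConfusion h
  have key : ∀ i < 6, ∀ p < 768, (lanesWith i).testBit p = true →
      (p / 12).testBit i = true := by decide +kernel
  exact ⟨hp, key i hi p hp h⟩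

/-- Moving up by `2 ^ i` lanes adds `2 ^ i` to a code whose bit `i` is clear, which is the same as
setting that bit. Only upper bounds on the occupied lanes are needed for soundness, so the converse
is left out. -/
theorem testBit_insertBit {i A p : ℕ} (hi : i < 6) (h : (insertBit i A).testBit p = true) :
    ∃ q, A.testBit q = true ∧ p / 12 = q / 12 ||| 2 ^ i := by
  have add_bit : ∀ i < 6, ∀ c < 64, c.testBit i = false → c + 2 ^ i = c ||| 2 ^ i := by
    decide +kernel
  have keep_bit : ∀ i < 6, ∀ c < 64, c.testBit i = true → c = c ||| 2 ^ i := by decide +kernel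
  change (((A &&& lanesWithout i) <<< (12 * 2 ^ i)) ||| (A &&& lanesWith i)).testBit p = true at h
  rw [Nat.testBit_or, Bool.or_eq_true, Nat.testBit_shiftLeft, Bool.and_eq_true, Nat.testBit_and,
    Nat.testBit_and, Bool.and_eq_true, Bool.and_eq_true, decide_eq_true_eq] at h
  rcases h with ⟨hp, hA, hb⟩ | ⟨hA, hb⟩
  · obtain ⟨hq, hb⟩ := testBit_lanesWithout hi hb
    refine ⟨_, hA, ?_⟩
    rw [← add_bit i hi _ (by omega) hb]
    omega
  · obtain ⟨hq, hb⟩ := testBit_lanesWith hi hb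
    exact ⟨_, hA, keep_bit i hi _ (by omega) hb⟩

theorem testBit_insertBitIf {i S A p : ℕ} (hi : i < 6)
    (h : (insertBitIf i S A).testBit p = true) :
    ∃ q, A.testBit q = true ∧
      p / 12 = q / 12 ||| (bif Nat.beq (bitAt i S) 1 then 2 ^ i else 0) := by
  unfold insertBitIf at h
  cases hb : Nat.beq (bitAt i S) 1 with
  | true => exact testBit_insertBit hi (by simpa [hb] using h)
  | false => exact ⟨p, by simpa [hb] using h, by simp⟩

theorem testBit_joinAll {S A p : ℕ} (hS : S < 64) (h : (joinAll S A).testBit p = true) :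
    ∃ q, A.testBit q = true ∧ p / 12 = q / 12 ||| S := by
  have key : ∀ S < 64, (bif Nat.beq (bitAt 0 S) 1 then 2 ^ 0 else 0) |||
      ((bif Nat.beq (bitAt 1 S) 1 then 2 ^ 1 else 0) |||
      ((bif Nat.beq (bitAt 2 S) 1 then 2 ^ 2 else 0) |||
      ((bif Nat.beq (bitAt 3 S) 1 then 2 ^ 3 else 0) |||
      ((bif Nat.beq (bitAt 4 S) 1 then 2 ^ 4 else 0) |||
      (bif Nat.beq (bitAt 5 S) 1 then 2 ^ 5 else 0))))) = S := by decide +kernel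
  obtain ⟨q5, h, e5⟩ := testBit_insertBitIf (by norm_num) h
  obtain ⟨q4, h, e4⟩ := testBit_insertBitIf (by norm_num) h
  obtain ⟨q3, h, e3⟩ := testBit_insertBitIf (by norm_num) h
  obtain ⟨q2, h, e2⟩ := testBit_insertBitIf (by norm_num) h
  obtain ⟨q1, h, e1⟩ := testBit_insertBitIf (by norm_num) h
  obtain ⟨q0, h, e0⟩ := testBit_insertBitIf (by norm_num) h
  refine ⟨q0, h, ?_⟩
  rw [e5, e4, e3, e2, e1, e0]
  simp only [Nat.or_assoc]
  rw [key S hS]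

theorem lanesIn_joinAll {S A : ℕ} {X : Set ℕ} (hS : S < 64)
    (hA : LanesIn A {T | T ||| S ∈ X}) : LanesIn (joinAll S A) X := by
  intro p hp
  obtain ⟨q, hq, e⟩ := testBit_joinAll hS hp
  rw [e]
  exact hA q hq

theorem lanesIn_closureLanes {X : Set ℕ} : ∀ l : List ℕ, (∀ g ∈ l, g < 64) →
    (∀ g ∈ l, ∀ S ∈ X, S ||| g ∈ X) → LanesIn (closureLanes l) {T | ∀ S ∈ X, S ||| T ∈ X}
  | [], _, _ => by
    intro p hp
    rw [testBit_fullLane (S := 0) |>.1 hp]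
    intro S hS
    simpa using hS
  | g :: l, h64, hX => by
    have ih := lanesIn_closureLanes l (fun x hx => h64 x (List.mem_cons_of_mem _ hx))
      (fun x hx => hX x (List.mem_cons_of_mem _ hx))
    refine ih.lor (lanesIn_joinAll (h64 g List.mem_cons_self) fun p hp S hS => ?_)
    rw [← Nat.or_assoc]
    exact hX g List.mem_cons_self _ (ih p hp S hS)

/-- Masking keeps at most the digits of lanes in `X`, and since `4096 ≡ 1` modulo `4095` the
remainder is at most the digit sum. An inequality is enough, so wrap-around is harmless. -/
theorem land_laneSum_mod_le {f : ℕ → ℕ} (hf : ∀ k, f k < 4096) {A : ℕ} {X : Finset ℕ}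
    (hA : LanesIn A X) (n : ℕ) :
    Nat.land A (laneSum f n) % 4095 ≤ ∑ k ∈ Finset.range n, if k ∈ X then f k else 0 := by
  have hlt : ∀ n, laneSum f n < 2 ^ (12 * n) := by
    intro n
    induction n with
    | zero => simp [laneSum]
    | succ n ih =>
      change laneSum f n + (f n) <<< (12 * n) < _
      rw [Nat.shiftLeft_eq, Nat.mul_succ, Nat.pow_add]
      have : (f n + 1) * 2 ^ (12 * n) ≤ 2 ^ 12 * 2 ^ (12 * n) :=
        Nat.mul_le_mul_right _ (hf n)
      nlinarith
  induction n with
  | zero => simp [laneSum]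
  | succ n ih =>
    have e : Nat.land A (laneSum f (n + 1)) =
        ((A >>> (12 * n)) &&& f n) * 2 ^ (12 * n) + Nat.land A (laneSum f n) := by
      change A &&& (laneSum f n + (f n) <<< (12 * n)) = _ + (A &&& laneSum f n)
      have hlow : A &&& laneSum f n < 2 ^ (12 * n) := Nat.and_le_right.trans_lt (hlt n)
      rw [← Nat.shiftLeft_eq, Nat.shiftLeft_add_eq_or_of_lt hlow, Nat.add_comm,
        Nat.shiftLeft_add_eq_or_of_lt (hlt n), Nat.and_or_distrib_left]
      congr 1
      refine Nat.eq_of_testBit_eq fun p => ?_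
      simp only [Nat.testBit_and, Nat.testBit_shiftLeft, Nat.testBit_shiftRight]
      by_cases hp : 12 * n ≤ p
      · simp [hp]
      · simp [hp]
    have hh : (A >>> (12 * n)) &&& f n ≤ if n ∈ X then f n else 0 := by
      split_ifs with hn
      · exact Nat.and_le_right
      · refine le_of_eq (Nat.eq_of_testBit_eq fun j => ?_)
        rw [Nat.zero_testBit, Bool.eq_false_iff]
        intro hj
        rw [Nat.testBit_and, Bool.and_eq_true, Nat.testBit_shiftRight] at hj
        have hj12 : j < 12 := by
          by_contra hj12
          have : f n < 2 ^ j := (hf n).trans_le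
            (by simpa using Nat.pow_le_pow_right (n := 2) (by norm_num) (not_lt.1 hj12))
          rw [Nat.testBit_lt_two_pow this] at hj
          exact Bool.noConfusion hj.2
        have := hA _ hj.1
        rw [show (12 * n + j) / 12 = n by omega] at this
        exact hn this
    have hmod : 2 ^ (12 * n) % 4095 = 1 := by
      rw [pow_mul, Nat.pow_mod]
      norm_num
    rw [Finset.sum_range_succ, e, Nat.add_mod, Nat.mul_mod, hmod, mul_one, Nat.mod_mod]
    refine (Nat.mod_le _ _).trans ?_
    have := Nat.mod_le ((A >>> (12 * n)) &&& f n) 4095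
    omega

/-! ### Soundness of the branch and bound -/

theorem sum_insert_le (f : ℕ → ℕ) (a : ℕ) (s : Finset ℕ) :
    ∑ x ∈ insert a s, f x ≤ f a + ∑ x ∈ s, f x := by
  by_cases h : a ∈ s
  · rw [Finset.insert_eq_of_mem h]
    exact Nat.le_add_left _ _
  · rw [Finset.sum_insert h]

/-- A fixed `X` is followed down its own branch. The invariant is that `A` lies inside `X`, `E`
outside it, and `D` bounds the deficit of the decided members of `X` plus that of all undecided
codes. -/
theorem search_sound {P G : ℕ} {X : Finset ℕ} {pos neg : ℕ → ℕ}
    (hX : ∀ S ∈ X, ∀ T ∈ X, S ||| T ∈ X)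
    (hP : ∀ A, LanesIn A X → Nat.land A P % 4095 ≤ ∑ S ∈ X, pos S)
    (hG : LanesIn G {T | ∀ S ∈ X, S ||| T ∈ X}) :
    ∀ (L : List (ℕ × ℕ)) (A E D : ℕ), (∀ x ∈ L, x.1 < 64 ∧ x.2 = neg x.1) →
      LanesIn A X → LanesIn E (X : Set ℕ)ᶜ →
      ∑ S ∈ X \ (L.map Prod.fst).toFinset, neg S + (L.map Prod.snd).sum ≤ D →
      search P G L A E D = true → ∑ S ∈ X, neg S ≤ ∑ S ∈ X, pos S
  | [], A, E, D, _, hA, _, hD, h => by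
    have h1 : D ≤ Nat.land A P % 4095 := Nat.le_of_ble_eq_true h
    simp only [List.map_nil, List.toFinset_nil, Finset.sdiff_empty, List.sum_nil] at hD
    have := hP A hA
    omega
  | x :: L, A, E, D, hL, hA, hE, hD, h => by
    have hsub : ∑ S ∈ X, neg S ≤
        ∑ S ∈ X \ ((x :: L).map Prod.fst).toFinset, neg S + ((x :: L).map Prod.snd).sum := by
      have hlist : ∀ M : List (ℕ × ℕ), (∀ y ∈ M, y.2 = neg y.1) →
          ∑ S ∈ (M.map Prod.fst).toFinset, neg S ≤ (M.map Prod.snd).sum := by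
        intro M
        induction M with
        | nil => simp
        | cons y M ih =>
          intro hM
          have := ih fun z hz => hM z (List.mem_cons_of_mem _ hz)
          rw [List.map_cons, List.toFinset_cons, List.map_cons, List.sum_cons,
            hM y List.mem_cons_self]
          exact (sum_insert_le _ _ _).trans (by omega)
      refine le_trans ?_ (Nat.add_le_add_left (hlist (x :: L) fun y hy => (hL y hy).2) _)
      rw [← Finset.sum_union Finset.sdiff_disjoint]
      refine Finset.sum_le_sum_of_subset ?_
      rw [Finset.sdiff_union_self_eq_union]
      exact Finset.subset_union_left
    obtain ⟨hx64, hxn⟩ := hL x List.mem_cons_self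
    have hL' : ∀ y ∈ L, y.1 < 64 ∧ y.2 = neg y.1 := fun y hy => hL y (List.mem_cons_of_mem _ hy)
    have hXL : X \ (L.map Prod.fst).toFinset ⊆
        insert x.1 (X \ ((x :: L).map Prod.fst).toFinset) := by
      intro S
      simp only [List.map_cons, List.toFinset_cons, Finset.mem_sdiff, Finset.mem_insert]
      tauto
    rw [search] at h
    have hD' : ((x :: L).map Prod.snd).sum = neg x.1 + (L.map Prod.snd).sum := by
      rw [List.map_cons, List.sum_cons, hxn]
    have hincl : ∑ S ∈ X \ (L.map Prod.fst).toFinset, neg S + (L.map Prod.snd).sum ≤ D := by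
      have := (Finset.sum_le_sum_of_subset (f := neg) hXL).trans (sum_insert_le _ _ _)
      omega
    cases h1 : Nat.ble D (Nat.mod (Nat.land A P) 4095) with
    | true =>
      have h2 : D ≤ Nat.land A P % 4095 := Nat.le_of_ble_eq_true h1
      have := hP A hA
      omega
    | false =>
    rw [h1, cond_false] at h
    cases h2 : Nat.beq (Nat.land A (fullLane x.1)) 0 with
    | false =>
      rw [h2, cond_false] at h
      exact search_sound hX hP hG L A E D hL' hA hE hincl h
    | true =>
    rw [h2, cond_true] at h
    cases h3 : search P G L A (Nat.lor E (fullLane x.1)) (Nat.sub D x.2) with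
    | false =>
      rw [h3, cond_false] at h
      exact Bool.noConfusion h
    | true =>
    rw [h3, cond_true] at h
    by_cases hxX : x.1 ∈ X
    · have hjoin : LanesIn (Nat.lor A (joinAll x.1 (Nat.lor A G))) X := by
        refine hA.lor (lanesIn_joinAll hx64 (LanesIn.lor (fun p hp => ?_) fun p hp => ?_))
        · exact hX _ (hA p hp) _ hxX
        · have := hG p hp _ hxX
          rwa [Nat.or_comm] at this
      -- As `X` itself realises this branch, the forced sets cannot meet the excluded ones, so the
      -- search did not stop here for inconsistency.
      rw [land_eq_zero_of_lanesIn hjoin hE] at h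
      exact search_sound hX hP hG L _ E D hL' hjoin hE hincl h
    · refine search_sound hX hP hG L A _ _ hL' hA (hE.lor (lanesIn_fullLane hxX)) ?_ h3
      have hsd : X \ (L.map Prod.fst).toFinset = X \ ((x :: L).map Prod.fst).toFinset := by
        ext S
        simp only [List.map_cons, List.toFinset_cons, Finset.mem_sdiff, Finset.mem_insert]
        constructor
        · rintro ⟨hS, hSL⟩
          refine ⟨hS, ?_⟩
          rintro (rfl | h)
          exacts [hxX hS, hSL h]
        · tauto
      rw [hsd]
      change _ ≤ D - x.2
      omega

theorem check_sound {w l : List ℕ} {X : Finset ℕ} (hw : w.sum < 4096)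
    (hwS : ∀ S, weight w S ≤ w.sum) (hX : ∀ S ∈ X, ∀ T ∈ X, S ||| T ∈ X)
    (h64 : ∀ S ∈ X, S < 64) (hl : ∀ g ∈ l, g < 64) (hlX : ∀ g ∈ l, ∀ S ∈ X, S ||| g ∈ X)
    (h : check w l = true) : w.sum * X.card ≤ ∑ S ∈ X, 2 * weight w S := by
  have hcodes : ∀ S ∈ smallCodes, S < 64 := by decide +kernel
  have hall : ∀ S < 64, S ∈ smallCodes := by decide +kernel
  have hnd : smallCodes.Nodup := by decide +kernel
  have hsur : ∀ S, surplus w S = 2 * weight w S - w.sum := fun S => rfl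
  have hdef : ∀ S, deficit w S = w.sum - 2 * weight w S := fun S => rfl
  have hle : ∑ S ∈ X, deficit w S ≤ ∑ S ∈ X, surplus w S := by
    unfold check at h
    refine search_sound (X := X) (pos := surplus w) (neg := deficit w) hX (fun A hA => ?_)
      (lanesIn_closureLanes l hl hlX) _ _ _ _ ?_ (lanesIn_zero _) (lanesIn_zero _) ?_ h
    · refine (land_laneSum_mod_le (fun k => ?_) hA 64).trans ?_
      · have := hwS k
        rw [hsur]
        omega
      · rw [← Finset.sum_filter]
        refine Finset.sum_le_sum_of_subset fun k hk => (Finset.mem_filter.1 hk).2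
    · intro x hx
      obtain ⟨S, hS, rfl⟩ := List.mem_map.1 (List.mem_filter.1 hx).1
      exact ⟨hcodes S hS, rfl⟩
    · have hzero : ∑ S ∈ X \ ((((smallCodes.map fun S => (S, deficit w S)).filter
          fun x => Nat.blt 0 x.2)).map Prod.fst).toFinset, deficit w S = 0 := by
        refine Finset.sum_eq_zero fun S hS => ?_
        rw [Finset.mem_sdiff] at hS
        by_contra hne
        refine hS.2 (List.mem_toFinset.2 (List.mem_map.2 ⟨(S, deficit w S),
          List.mem_filter.2 ⟨List.mem_map.2 ⟨S, hall S (h64 S hS.1), rfl⟩, ?_⟩, rfl⟩))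
        exact Nat.ble_eq_true_of_le (Nat.pos_of_ne_zero hne)
      rw [hzero, zero_add]
      refine ((List.filter_sublist.map _).sum_le_sum (fun _ _ => Nat.zero_le _)).trans ?_
      rw [List.map_map]
      rfl
  -- Truncated subtraction splits `2 w(S) - w(U)` into its positive and negative parts.
  have hsum : ∑ S ∈ X, (w.sum + surplus w S) = ∑ S ∈ X, (2 * weight w S + deficit w S) :=
    Finset.sum_congr rfl fun S _ => by rw [hsur, hdef]; omega
  rw [Finset.sum_add_distrib, Finset.sum_add_distrib, Finset.sum_const, smul_eq_mul] at hsum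
  rw [mul_comm]
  omega

/-! ### From weights to a frequent element -/

theorem weight_eq_sum : ∀ (w : List ℕ) (S : ℕ),
    weight w S = ∑ i ∈ Finset.range w.length, if S.testBit i then w.getD i 0 else 0
  | [], S => by simp [weight]
  | a :: w, S => by
    rw [List.length_cons, Finset.sum_range_succ']
    change a * (S % 2) + weight w (S / 2) = _
    rw [weight_eq_sum w (S / 2), add_comm]
    congr 1
    · simp [Nat.testBit_succ]
    · rcases Nat.mod_two_eq_zero_or_one S with h | h <;> simp [Nat.testBit_zero, h]

theorem sum_eq_sum_getD : ∀ w : List ℕ, w.sum = ∑ i ∈ Finset.range w.length, w.getD i 0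
  | [] => by simp
  | a :: w => by
    rw [List.length_cons, Finset.sum_range_succ', List.sum_cons, sum_eq_sum_getD w, add_comm]
    simp

theorem weight_le_sum (w : List ℕ) (S : ℕ) : weight w S ≤ w.sum := by
  rw [weight_eq_sum, sum_eq_sum_getD]
  exact Finset.sum_le_sum fun i _ => by split_ifs <;> simp

/-- The trace of `S` on the labelled points `e 0, …, e 5`, as a binary number. -/
def code (e : Fin 6 → ℕ) (S : Finset ℕ) : ℕ := Nat.ofBits fun i => decide (e i ∈ S)

theorem testBit_code (e : Fin 6 → ℕ) (S : Finset ℕ) (i : Fin 6) :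
    (code e S).testBit i = decide (e i ∈ S) := by
  rw [code, Nat.testBit_ofBits_lt _ _ i.2]

theorem testBit_code_of_le (e : Fin 6 → ℕ) (S : Finset ℕ) {i : ℕ} (hi : 6 ≤ i) :
    (code e S).testBit i = false := Nat.testBit_ofBits_ge _ _ hi

theorem code_lt (e : Fin 6 → ℕ) (S : Finset ℕ) : code e S < 64 := Nat.ofBits_lt_two_pow _

theorem eq_of_testBit_lt_six {a b : ℕ} (ha : ∀ i, 6 ≤ i → a.testBit i = false)
    (hb : ∀ i, 6 ≤ i → b.testBit i = false) (h : ∀ i : Fin 6, a.testBit i = b.testBit i) :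
    a = b := by
  refine Nat.eq_of_testBit_eq fun i => ?_
  rcases lt_or_ge i 6 with hi | hi
  · exact h ⟨i, hi⟩
  · rw [ha i hi, hb i hi]

theorem code_union (e : Fin 6 → ℕ) (S T : Finset ℕ) : code e (S ∪ T) = code e S ||| code e T := by
  refine eq_of_testBit_lt_six (fun i hi => testBit_code_of_le e _ hi) (fun i hi => ?_) fun i => ?_
  · rw [Nat.testBit_or, testBit_code_of_le e _ hi, testBit_code_of_le e _ hi, Bool.or_false]
  · simp only [Nat.testBit_or, testBit_code, Finset.mem_union, Bool.decide_or]

theorem mem_iff_of_code_eq {e : Fin 6 → ℕ} {S T : Finset ℕ} (h : code e S = code e T) {a : ℕ}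
    (ha : a ∈ Finset.univ.image e) : a ∈ S ↔ a ∈ T := by
  obtain ⟨i, -, rfl⟩ := Finset.mem_image.1 ha
  have := congrArg (fun n => n.testBit i) h
  simpa only [testBit_code, decide_eq_decide] using this

theorem weight_code {w : List ℕ} (hw : w.length = 6) (e : Fin 6 → ℕ) (S : Finset ℕ) :
    weight w (code e S) = ∑ i : Fin 6, if e i ∈ S then w.getD i 0 else 0 := by
  rw [weight_eq_sum, hw, Finset.sum_range]
  simp only [testBit_code, decide_eq_true_eq]

/-- A union-closed family containing sets with codes `l` has a frequent element, if the shares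
given by some weights pass the test `check`. -/
theorem exists_card_le_of_check {F : Finset (Finset ℕ)} (hF : SupClosed (F : Set (Finset ℕ)))
    {e : Fin 6 → ℕ} {w l : List ℕ}
    (hl : ∀ c ∈ l, ∃ g ∈ F, g ⊆ Finset.univ.image e ∧ code e g = c) (hw6 : w.length = 6)
    (hpos : 0 < w.sum) (hlt : w.sum < 4096) (h : check w l = true) :
    ∃ i, F.card ≤ 2 * (F.filter fun A => e i ∈ A).card := by
  set U := Finset.univ.image e with hU
  have hclass : ∀ T ∈ F.image (· \ U), w.sum * (F.filter fun S => S \ U = T).card ≤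
      ∑ S ∈ F.filter (fun S => S \ U = T), 2 * weight w (code e S) := by
    intro T _
    -- Within a class the part outside `U` is fixed, so the trace determines the set and counting
    -- traces counts members.
    have hinj : Set.InjOn (code e) (F.filter fun S => S \ U = T : Finset (Finset ℕ)) := by
      intro S hS S' hS' heq
      rw [Finset.mem_coe, Finset.mem_filter] at hS hS'
      ext a
      by_cases ha : a ∈ U
      · exact mem_iff_of_code_eq heq ha
      · have := congrArg (a ∈ ·) (hS.2.trans hS'.2.symm)
        simpa [ha] using this
    rw [← Finset.card_image_of_injOn hinj, ← Finset.sum_image (f := fun c => 2 * weight w c) hinj]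
    refine check_sound hlt (weight_le_sum w) ?_ ?_ ?_ ?_ h
    · intro c hc d hd
      obtain ⟨S, hS, rfl⟩ := Finset.mem_image.1 hc
      obtain ⟨S', hS', rfl⟩ := Finset.mem_image.1 hd
      rw [Finset.mem_filter] at hS hS'
      refine Finset.mem_image.2 ⟨S ∪ S', Finset.mem_filter.2 ⟨hF hS.1 hS'.1, ?_⟩, code_union _ _ _⟩
      rw [Finset.union_sdiff_distrib, hS.2, hS'.2, Finset.union_self]
    · intro c hc
      obtain ⟨S, hS, rfl⟩ := Finset.mem_image.1 hc
      exact code_lt e S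
    · intro c hc
      obtain ⟨g, -, -, rfl⟩ := hl c hc
      exact code_lt e g
    · intro c hc d hd
      obtain ⟨g, hg, hgU, rfl⟩ := hl c hc
      obtain ⟨S, hS, rfl⟩ := Finset.mem_image.1 hd
      rw [Finset.mem_filter] at hS
      refine Finset.mem_image.2 ⟨S ∪ g, Finset.mem_filter.2 ⟨hF hS.1 hg, ?_⟩, code_union _ _ _⟩
      rw [Finset.union_sdiff_distrib, hS.2, Finset.sdiff_eq_empty_iff_subset.2 hgU,
        Finset.union_empty]
  have htotal : w.sum * F.card ≤ ∑ S ∈ F, 2 * weight w (code e S) := by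
    rw [Finset.card_eq_sum_card_image (· \ U) F, Finset.mul_sum,
      ← Finset.sum_fiberwise_of_maps_to (g := (· \ U)) (t := F.image (· \ U))
        (fun S hS => Finset.mem_image_of_mem _ hS)]
    exact Finset.sum_le_sum hclass
  have hswap : ∑ S ∈ F, 2 * weight w (code e S) =
      ∑ i : Fin 6, w.getD i 0 * (2 * (F.filter fun A => e i ∈ A).card) := by
    simp only [weight_code hw6, Finset.mul_sum]
    rw [Finset.sum_comm]
    refine Finset.sum_congr rfl fun i _ => ?_
    rw [← Finset.mul_sum, ← Finset.sum_filter, Finset.sum_const, smul_eq_mul]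
    ring
  have hsum : w.sum = ∑ i : Fin 6, w.getD i 0 := by
    rw [sum_eq_sum_getD, hw6, Finset.sum_range]
  by_contra! hcon
  rw [hswap, hsum, Finset.sum_mul] at htotal
  rw [hsum] at hpos
  obtain ⟨i, -, hi⟩ := Finset.exists_ne_zero_of_sum_ne_zero hpos.ne'
  refine absurd htotal (not_le.2 (Finset.sum_lt_sum (fun j _ => ?_) ⟨i, Finset.mem_univ i, ?_⟩))
  · exact Nat.mul_le_mul_left _ (hcon j).le
  · exact Nat.mul_lt_mul_of_pos_left (hcon i) (Nat.pos_of_ne_zero hi)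

/-! ### Septuples of four-sets up to relabelling -/

/-- Exchange the bits `i` and `j` of `c`. -/
def swapBits (i j c : ℕ) : ℕ :=
  bif Nat.beq (bitAt i c) (bitAt j c) then c else Nat.xor (Nat.xor c (2 ^ i)) (2 ^ j)

def maskVia (φ : ℕ → ℕ) : List ℕ → ℕ
  | [] => 0
  | c :: l => Nat.add (Nat.pow 2 (φ c)) (maskVia φ l)

def transpositions : List (ℕ × ℕ) := [(0, 1), (0, 2), (0, 3), (0, 4), (0, 5), (1, 2), (1, 3),
  (1, 4), (1, 5), (2, 3), (2, 4), (2, 5), (3, 4), (3, 5), (4, 5)]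

/-- The binary codes of the four-element subsets of a six-element set. -/
def fourCodes : List ℕ := [15, 23, 27, 29, 30, 39, 43, 45, 46, 51, 53, 54, 57, 58, 60]

def weightTable : List (ℕ × List ℕ) := [
  (9347602087936, [2, 2, 2, 2, 1, 1]), (2286985939025920, [5, 4, 4, 4, 4, 3]),
  (44530900434944, [5, 4, 4, 4, 3, 3]), (2261146342031360, [6, 5, 4, 4, 4, 3]),
  (2287534621097984, [5, 4, 4, 4, 4, 3]), (44531437305856, [2, 2, 2, 2, 1, 1]),
  (2287535157968896, [3, 3, 3, 3, 2, 2]), (2261147281555456, [5, 5, 5, 4, 4, 3]),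
  (2287535686451200, [4, 4, 4, 4, 3, 3]), (11302980741529600, [4, 4, 4, 4, 4, 3]),
  (2296331645255680, [4, 4, 4, 4, 3, 3]), (44531974144000, [4, 4, 4, 4, 3, 3]),
  (2296330714087424, [4, 3, 3, 3, 3, 3]), (2296331250958336, [5, 5, 4, 4, 4, 4]),
  (2296331653611520, [4, 4, 4, 3, 4, 3]), (2357904304766976, [4, 4, 4, 3, 4, 4])]

/-- Masks missing from the table get uniform weights. -/
def weightsFor (m : ℕ) : List ℕ := (weightTable.lookup m).getD [1, 1, 1, 1, 1, 1]

/-- Either a product of at most two transpositions lowers the mask of `l`, or `l` passes the test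
`check` with the weights listed for it. -/
def reducibleOrCheck (l : List ℕ) : Bool :=
  bif transpositions.any fun t =>
    Nat.blt (maskVia (swapBits t.1 t.2) l) (maskVia id l) then true
  else bif transpositions.any fun t => transpositions.any fun u =>
    Nat.blt (maskVia (fun c => swapBits t.1 t.2 (swapBits u.1 u.2 c)) l) (maskVia id l) then true
  else check (weightsFor (maskVia id l)) l

theorem reducibleOrCheck_sublistsLen :
    (fourCodes.sublistsLen 7).all reducibleOrCheck = true := by
  decide +kernel

theorem testBit_swapBits {i j : ℕ} (hij : i ≠ j) (c k : ℕ) :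
    (swapBits i j c).testBit k = c.testBit (Equiv.swap i j k) := by
  have hbit : ∀ i c : ℕ, bitAt i c = (c.testBit i).toNat := fun i c => by
    change (c >>> i) &&& 1 = _
    rw [Nat.and_one_is_mod, Nat.toNat_testBit, Nat.shiftRight_eq_div_pow]
  have hbeq : Nat.beq (bitAt i c) (bitAt j c) = (c.testBit i == c.testBit j) := by
    rw [hbit, hbit]
    cases c.testBit i <;> cases c.testBit j <;> rfl
  rw [swapBits, hbeq]
  change (bif _ then c else c ^^^ 2 ^ i ^^^ 2 ^ j).testBit k = _
  rcases eq_or_ne k i with rfl | hki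
  · rw [Equiv.swap_apply_left]
    cases hi : c.testBit k <;> cases hj : c.testBit j <;>
      simp [Nat.testBit_xor, hi, hij.symm]
  rcases eq_or_ne k j with rfl | hkj
  · rw [Equiv.swap_apply_right]
    cases hi : c.testBit i <;> cases hj : c.testBit k <;>
      simp [Nat.testBit_xor, hj, hij]
  · rw [Equiv.swap_apply_of_ne_of_ne hki hkj]
    cases hi : c.testBit i <;> cases hj : c.testBit j <;>
      simp [Nat.testBit_xor, hki.symm, hkj.symm]

theorem code_comp_swap (e : Fin 6 → ℕ) (S : Finset ℕ) {i j : Fin 6} (hij : i ≠ j) :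
    code (e ∘ Equiv.swap i j) S = swapBits i j (code e S) := by
  have hne : (i : ℕ) ≠ j := fun h => hij (Fin.ext h)
  refine eq_of_testBit_lt_six (fun k hk => testBit_code_of_le _ _ hk) (fun k hk => ?_) fun k => ?_
  · rw [testBit_swapBits hne, Equiv.swap_apply_of_ne_of_ne (by omega) (by omega)]
    exact testBit_code_of_le _ _ hk
  · have hk : Equiv.swap (i : ℕ) j k = (Equiv.swap i j k : Fin 6) := by
      simp only [Equiv.swap_apply_def, ← Fin.ext_iff]
      split_ifs <;> rfl
    rw [testBit_swapBits hne, hk, testBit_code, testBit_code, Function.comp_apply]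

theorem maskVia_eq_sum (φ : ℕ → ℕ) : ∀ l : List ℕ, maskVia φ l = (l.map fun c => 2 ^ φ c).sum
  | [] => rfl
  | c :: l => by
    rw [List.map_cons, List.sum_cons, ← maskVia_eq_sum φ l]
    rfl

theorem code_mem_fourCodes {e : Fin 6 → ℕ} (he : e.Injective) {S : Finset ℕ} (hS : S.card = 4)
    (hSe : S ⊆ Finset.univ.image e) : code e S ∈ fourCodes := by
  have key : ∀ c < 64, (Finset.univ.filter fun i : Fin 6 => c.testBit i = true).card = 4 →
      c ∈ fourCodes := by decide +kernel
  refine key _ (code_lt e S) ?_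
  simp only [testBit_code, decide_eq_true_eq]
  rw [← hS, ← Finset.card_image_of_injective _ he]
  congr 1
  ext a
  simp only [Finset.mem_image, Finset.mem_filter, Finset.mem_univ, true_and]
  constructor
  · rintro ⟨i, hi, rfl⟩
    exact hi
  · intro ha
    obtain ⟨i, -, rfl⟩ := Finset.mem_image.1 (hSe ha)
    exact ⟨i, ha, rfl⟩

theorem code_injOn (e : Fin 6 → ℕ) {G : Finset (Finset ℕ)}
    (hG : ∀ A ∈ G, A ⊆ Finset.univ.image e) : Set.InjOn (code e) G := by
  intro A hA B hB h
  ext a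
  exact ⟨fun ha => (mem_iff_of_code_eq h (hG A hA ha)).1 ha,
    fun ha => (mem_iff_of_code_eq h (hG B hB ha)).2 ha⟩

theorem maskVia_codes {e : Fin 6 → ℕ} (he : e.Injective) {G : Finset (Finset ℕ)}
    (h4 : ∀ A ∈ G, A.card = 4) (hG : ∀ A ∈ G, A ⊆ Finset.univ.image e) (φ : ℕ → ℕ) :
    maskVia φ (fourCodes.filter (· ∈ G.image (code e))) = ∑ A ∈ G, 2 ^ φ (code e A) := by
  have hnd : fourCodes.Nodup := by decide +kernel
  rw [maskVia_eq_sum, ← List.sum_toFinset _ (hnd.filter _),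
    ← Finset.sum_image (f := fun c => 2 ^ φ c) (code_injOn e hG)]
  refine Finset.sum_congr ?_ fun _ _ => rfl
  ext c
  simp only [List.mem_toFinset, List.mem_filter, decide_eq_true_eq, and_iff_right_iff_imp]
  intro hc
  obtain ⟨A, hA, rfl⟩ := Finset.mem_image.1 hc
  exact code_mem_fourCodes he (h4 A hA) (hG A hA)

/-- Seven four-element subsets of a six-element set can be labelled so that they pass `check`. -/
theorem exists_check {G : Finset (Finset ℕ)} (hG7 : G.card = 7) (h4 : ∀ A ∈ G, A.card = 4)
    {U : Finset ℕ} (hU : U.card = 6) (hGU : ∀ A ∈ G, A ⊆ U) :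
    ∃ e : Fin 6 → ℕ, Finset.univ.image e = U ∧ ∃ m l, check (weightsFor m) l = true ∧
      ∀ c ∈ l, ∃ A ∈ G, code e A = c := by
  let e₀ : Fin 6 → ℕ := fun i => (U.equivFinOfCardEq hU).symm i
  have he₀ : e₀.Injective := Subtype.val_injective.comp (Equiv.injective _)
  have hU₀ : Finset.univ.image e₀ = U := by
    refine Finset.eq_of_subset_of_card_le (fun a ha => ?_) ?_
    · obtain ⟨i, -, rfl⟩ := Finset.mem_image.1 ha
      exact Subtype.property _
    · rw [Finset.card_image_of_injective _ he₀, hU, Finset.card_univ, Fintype.card_fin]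
  -- A labelling of minimal mask cannot be improved by transpositions, so both escape clauses of
  -- `reducibleOrCheck` fail and only `check` remains.
  obtain ⟨σ, -, hσ⟩ := Finset.exists_min_image (Finset.univ : Finset (Equiv.Perm (Fin 6)))
    (fun σ => ∑ A ∈ G, 2 ^ code (e₀ ∘ σ) A) Finset.univ_nonempty
  set e := e₀ ∘ σ with he
  have hinj : e.Injective := he₀.comp σ.injective
  have hUe : Finset.univ.image e = U := by
    rw [he, ← Finset.image_image, Finset.image_univ_equiv, hU₀]
  have hGe : ∀ A ∈ G, A ⊆ Finset.univ.image e := by rwa [hUe]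
  have htr : ∀ t ∈ transpositions, ∃ i j : Fin 6, i ≠ j ∧ t = ((i : ℕ), (j : ℕ)) := by
    decide +kernel
  set l := fourCodes.filter (· ∈ G.image (code e)) with hl
  have hlen : l.length = 7 := by
    have hnd : fourCodes.Nodup := by decide +kernel
    rw [← List.toFinset_card_of_nodup (hnd.filter _), ← hG7,
      ← Finset.card_image_of_injOn (code_injOn e hGe)]
    congr 1
    ext c
    simp only [List.mem_toFinset, List.mem_filter, decide_eq_true_eq, and_iff_right_iff_imp]
    intro hc
    obtain ⟨A, hA, rfl⟩ := Finset.mem_image.1 hc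
    exact code_mem_fourCodes hinj (h4 A hA) (hGe A hA)
  have hred := List.all_eq_true.1 reducibleOrCheck_sublistsLen l
    (List.mem_sublistsLen.2 ⟨List.filter_sublist, hlen⟩)
  have hmin : ∀ τ : Equiv.Perm (Fin 6), maskVia id l ≤ ∑ A ∈ G, 2 ^ code (e ∘ τ) A := by
    intro τ
    rw [maskVia_codes hinj h4 hGe]
    exact hσ (σ * τ) (Finset.mem_univ _)
  have hone : (transpositions.any fun t =>
      Nat.blt (maskVia (swapBits t.1 t.2) l) (maskVia id l)) = false := by
    rw [List.any_eq_false]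
    intro t ht
    obtain ⟨i, j, hij, rfl⟩ := htr t ht
    rw [maskVia_codes hinj h4 hGe]
    simp only [← code_comp_swap e _ hij]
    rw [Nat.blt_eq]
    exact not_lt.2 (hmin _)
  have htwo : (transpositions.any fun t => transpositions.any fun u =>
      Nat.blt (maskVia (fun c => swapBits t.1 t.2 (swapBits u.1 u.2 c)) l) (maskVia id l)) =
      false := by
    rw [List.any_eq_false]
    intro t ht
    rw [Bool.not_eq_true, List.any_eq_false]
    intro u hu
    obtain ⟨i, j, hij, rfl⟩ := htr t ht
    obtain ⟨i', j', hij', rfl⟩ := htr u hu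
    rw [maskVia_codes hinj h4 hGe]
    simp only [← code_comp_swap _ _ hij', ← code_comp_swap _ _ hij]
    rw [Nat.blt_eq]
    exact not_lt.2 (hmin (Equiv.swap i' j' * Equiv.swap i j))
  rw [reducibleOrCheck, hone, htwo, cond_false, cond_false] at hred
  refine ⟨e, hUe, _, l, hred, fun c hc => ?_⟩
  exact Finset.mem_image.1 (of_decide_eq_true (List.mem_filter.1 hc).2)

theorem weightsFor_bounds (m : ℕ) : (weightsFor m).length = 6 ∧ 0 < (weightsFor m).sum ∧
    (weightsFor m).sum < 4096 := by
  have key : ∀ x ∈ weightTable, x.2.length = 6 ∧ 0 < x.2.sum ∧ x.2.sum < 4096 := by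
    decide +kernel
  rw [weightsFor]
  cases h : weightTable.lookup m with
  | none => decide
  | some w =>
    obtain ⟨l₁, l₂, hw, -⟩ := List.lookup_eq_some_iff.1 h
    exact key (m, w) (by rw [hw]; simp)

theorem forcesFC_four_six_seven : ForcesFC 4 6 7 := by
  intro Fc G hGFc h4 hG7 hU F hF hFcF
  obtain ⟨H, hHG, hH7⟩ := Finset.exists_subset_card_eq hG7
  obtain ⟨e, he, m, l, hcheck, hl⟩ := exists_check hH7 (fun A hA => h4 A (hHG hA)) hU
    fun A hA => Finset.subset_biUnion_of_mem id (hHG hA)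
  obtain ⟨h6, hpos, hlt⟩ := weightsFor_bounds m
  obtain ⟨i, hi⟩ := exists_card_le_of_check hF (e := e) (fun c hc => by
    obtain ⟨A, hA, rfl⟩ := hl c hc
    exact ⟨A, hFcF (hGFc (hHG hA)), he ▸ Finset.subset_biUnion_of_mem id (hHG hA), rfl⟩)
    h6 hpos hlt hcheck
  refine ⟨e i, Finset.biUnion_subset_biUnion_of_subset_left id hGFc ?_, hi⟩
  rw [← he]
  exact Finset.mem_image_of_mem _ (Finset.mem_univ i)

/-! ### The family in which all six points are rare -/

/-- The subsets of `{0, …, 5}` with at least four elements that contain `4` and `5`. -/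
def coreSets : Finset (Finset ℕ) :=
  (Finset.range 6).powerset.filter fun S => 4 ∈ S ∧ 5 ∈ S ∧ 4 ≤ S.card

/-- Among the indices used, `{0, 1, 2, 3}` occurs 20 times, making `4` and `5` rare; each complement
of a point `j < 4` occurs 3 times, lowering the frequency of `j`. -/
def freePart (t : ℕ) : Finset ℕ :=
  if t < 6 then Finset.range 6 else if t < 26 then Finset.range 4 else (Finset.range 6).erase (t % 4)

/-- The traces on `{0, …, 5}` of the members of `counterexample` with tail `tailSet t`. -/
def sectionSets (t : ℕ) : Finset (Finset ℕ) :=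
  if t = 0 then coreSets else
    (Finset.range 6).powerset.filter fun S => (4 ∈ S ∧ 5 ∈ S ∧ 4 ≤ S.card) ∨ S ⊆ freePart t

/-- Erasing `1` has no effect, so index `1` gives the full tail, which is the union of any two
different nonempty tails. -/
def tailSet (t : ℕ) : Finset ℕ := if t = 0 then ∅ else (Finset.Ico 6 38).erase t

def tailIndices : Finset ℕ := insert 0 (insert 1 (Finset.Ico 6 38))

/-- A union-closed family containing `coreSets` in which each of `0, …, 5` is rare. -/
def counterexample : Finset (Finset ℕ) :=
  tailIndices.biUnion fun t => (sectionSets t).image (· ∪ tailSet t)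

theorem mem_counterexample {A : Finset ℕ} :
    A ∈ counterexample ↔ ∃ t ∈ tailIndices, ∃ S ∈ sectionSets t, S ∪ tailSet t = A := by
  simp [counterexample]

theorem subset_range_of_mem_sectionSets {t : ℕ} {S : Finset ℕ} (h : S ∈ sectionSets t) :
    S ⊆ Finset.range 6 := by
  unfold sectionSets coreSets at h
  split_ifs at h <;> exact Finset.mem_powerset.1 (Finset.mem_filter.1 h).1

theorem mem_sectionSets {t : ℕ} (ht : t ≠ 0) {S : Finset ℕ} : S ∈ sectionSets t ↔
    S ⊆ Finset.range 6 ∧ (S ∈ coreSets ∨ S ⊆ freePart t) := by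
  rw [sectionSets, if_neg ht, coreSets, Finset.mem_filter, Finset.mem_filter, Finset.mem_powerset]
  tauto

theorem union_mem_coreSets {S T : Finset ℕ} (hS : S ∈ coreSets) (hT : T ⊆ Finset.range 6) :
    S ∪ T ∈ coreSets := by
  rw [coreSets, Finset.mem_filter, Finset.mem_powerset] at hS ⊢
  exact ⟨Finset.union_subset hS.1 hT, Finset.mem_union_left _ hS.2.1,
    Finset.mem_union_left _ hS.2.2.1,
    hS.2.2.2.trans (Finset.card_le_card Finset.subset_union_left)⟩

theorem sectionSets_zero : sectionSets 0 = coreSets := if_pos rfl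

theorem supClosed_counterexample : SupClosed (counterexample : Set (Finset ℕ)) := by
  intro A hA B hB
  rw [Finset.mem_coe, mem_counterexample] at hA hB ⊢
  obtain ⟨t, ht, S, hS, rfl⟩ := hA
  obtain ⟨u, hu, T, hT, rfl⟩ := hB
  have hS6 := subset_range_of_mem_sectionSets hS
  have hT6 := subset_range_of_mem_sectionSets hT
  rw [Finset.sup_eq_union, Finset.union_union_union_comm]
  rcases eq_or_ne t 0 with rfl | ht0
  · rw [sectionSets_zero] at hS
    have hST := union_mem_coreSets hS hT6
    refine ⟨u, hu, S ∪ T, ?_, by simp [tailSet]⟩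
    rcases eq_or_ne u 0 with rfl | hu0
    · rwa [sectionSets_zero]
    · exact (mem_sectionSets hu0).2 ⟨Finset.union_subset hS6 hT6, Or.inl hST⟩
  rcases eq_or_ne u 0 with rfl | hu0
  · rw [sectionSets_zero] at hT
    refine ⟨t, ht, S ∪ T, ?_, by simp [tailSet]⟩
    have := union_mem_coreSets hT hS6
    rw [Finset.union_comm] at this
    exact (mem_sectionSets ht0).2 ⟨Finset.union_subset hS6 hT6, Or.inl this⟩
  rcases eq_or_ne t u with rfl | htu
  · refine ⟨t, ht, S ∪ T, (mem_sectionSets ht0).2 ⟨Finset.union_subset hS6 hT6, ?_⟩,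
      by rw [Finset.union_self]⟩
    rcases ((mem_sectionSets ht0).1 hS).2 with h | h
    · exact Or.inl (union_mem_coreSets h hT6)
    rcases ((mem_sectionSets ht0).1 hT).2 with h' | h'
    · have := union_mem_coreSets h' hS6
      rw [Finset.union_comm] at this
      exact Or.inl this
    · exact Or.inr (Finset.union_subset h h')
  -- Different nonempty tails unite to the full tail, whose section is the whole power set.
  · refine ⟨1, by decide, S ∪ T, (mem_sectionSets one_ne_zero).2
      ⟨Finset.union_subset hS6 hT6, Or.inr (Finset.union_subset hS6 hT6)⟩, ?_⟩
    congr 1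
    rw [tailSet, tailSet, tailSet, if_neg ht0, if_neg hu0, if_neg one_ne_zero]
    ext a
    simp only [Finset.mem_union, Finset.mem_erase, Finset.mem_Ico]
    omega

/-- Tails avoid `{0, …, 5}`, so a member determines its trace and its index. General `D` covers both
whole sections and their members containing a given point. -/
theorem card_biUnion_image_union_tailSet {D : ℕ → Finset (Finset ℕ)}
    (hD : ∀ t, ∀ S ∈ D t, S ⊆ Finset.range 6) :
    (tailIndices.biUnion fun t => (D t).image (· ∪ tailSet t)).card =
      ∑ t ∈ tailIndices, (D t).card := by
  have htail : ∀ t a, a ∈ tailSet t → 6 ≤ a := by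
    intro t a ha
    unfold tailSet at ha
    split_ifs at ha
    · simp at ha
    · exact (Finset.mem_Ico.1 (Finset.mem_of_mem_erase ha)).1
  have hinj : ∀ t ∈ tailIndices, ∀ u ∈ tailIndices, tailSet t = tailSet u → t = u := by
    decide +kernel
  rw [Finset.card_biUnion]
  · refine Finset.sum_congr rfl fun t _ => Finset.card_image_of_injOn fun S hS S' hS' h => ?_
    ext a
    have hSa : a ∈ S → a ∈ Finset.range 6 := fun h => hD t S hS h
    have hSa' : a ∈ S' → a ∈ Finset.range 6 := fun h => hD t S' hS' h
    have ha := htail t a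
    have := congrArg (a ∈ ·) h
    simp only [Finset.mem_union, Finset.mem_range, eq_iff_iff] at this hSa hSa'
    constructor
    · intro h1
      rcases this.1 (Or.inl h1) with h2 | h2
      · exact h2
      · exact absurd (ha h2) (not_le.2 (hSa h1))
    · intro h1
      rcases this.2 (Or.inl h1) with h2 | h2
      · exact h2
      · exact absurd (ha h2) (not_le.2 (hSa' h1))
  · intro t ht u hu htu
    refine Finset.disjoint_left.2 fun A hA hA' => htu (hinj t ht u hu ?_)
    obtain ⟨S, hS, rfl⟩ := Finset.mem_image.1 hA
    obtain ⟨S', hS', h⟩ := Finset.mem_image.1 hA'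
    ext a
    have hSa : a ∈ S → a ∈ Finset.range 6 := fun h => hD t S hS h
    have hSa' : a ∈ S' → a ∈ Finset.range 6 := fun h => hD u S' hS' h
    have := congrArg (a ∈ ·) h
    simp only [Finset.mem_union, Finset.mem_range, eq_iff_iff] at this hSa hSa'
    constructor
    · intro h1
      rcases this.2 (Or.inr h1) with h2 | h2
      · exact absurd (htail t a h1) (not_le.2 (hSa' h2))
      · exact h2
    · intro h1
      rcases this.1 (Or.inr h1) with h2 | h2
      · exact absurd (htail u a h1) (not_le.2 (hSa h2))
      · exact h2

theorem card_counterexample :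
    counterexample.card = ∑ t ∈ tailIndices, (sectionSets t).card :=
  card_biUnion_image_union_tailSet fun _ _ => subset_range_of_mem_sectionSets

theorem card_filter_mem_counterexample {a : ℕ} (ha : a < 6) :
    (counterexample.filter fun A => a ∈ A).card =
      ∑ t ∈ tailIndices, ((sectionSets t).filter fun S => a ∈ S).card := by
  have htail : ∀ t, a ∉ tailSet t := by
    intro t h
    unfold tailSet at h
    split_ifs at h
    · simp at h
    · exact absurd (Finset.mem_Ico.1 (Finset.mem_of_mem_erase h)).1 (not_le.2 ha)
  rw [← card_biUnion_image_union_tailSet fun t S hS =>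
    subset_range_of_mem_sectionSets (Finset.mem_of_mem_filter S hS), counterexample,
    Finset.filter_biUnion]
  simp only [Finset.filter_image, Finset.mem_union, htail, or_false]

theorem rare_counterexample {a : ℕ} (ha : a < 6) :
    2 * (counterexample.filter fun A => a ∈ A).card < counterexample.card := by
  -- Of 1083 sets, 540 contain each of `0, …, 3` and 539 contain each of `4, 5`.
  have key : ∀ a < 6, 2 * ∑ t ∈ tailIndices, ((sectionSets t).filter fun S => a ∈ S).card <
      ∑ t ∈ tailIndices, (sectionSets t).card := by decide +kernel
  rw [card_filter_mem_counterexample ha, card_counterexample]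
  exact key a ha

theorem not_isFCFamily_of_subset_coreSets {Fc : Finset (Finset ℕ)} (h : Fc ⊆ coreSets) :
    ¬ IsFCFamily Fc := by
  intro hFc
  obtain ⟨a, ha, hle⟩ := hFc counterexample supClosed_counterexample fun S hS =>
    mem_counterexample.2 ⟨0, by decide, S, sectionSets_zero ▸ h hS, by simp [tailSet]⟩
  obtain ⟨S, hS, haS⟩ := Finset.mem_biUnion.1 ha
  have hS6 := subset_range_of_mem_sectionSets (sectionSets_zero ▸ h hS)
  exact absurd hle (not_le.2 (rare_counterexample (Finset.mem_range.1 (hS6 haS))))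

/-- The sets `{i, j, 4, 5}` with `i < j < 4`, the first two of them covering `{0, …, 5}`. -/
def coreFours : List (Finset ℕ) := [{0, 1, 4, 5}, {2, 3, 4, 5}, {0, 2, 4, 5}, {0, 3, 4, 5},
  {1, 2, 4, 5}, {1, 3, 4, 5}]

theorem exists_not_isFCFamily {m : ℕ} (h2 : 2 ≤ m) (h6 : m ≤ 6) :
    ∃ Fc : Finset (Finset ℕ), Fc.card = m ∧ (∀ A ∈ Fc, A.card = 4) ∧
      (Fc.biUnion id).card = 6 ∧ ¬ IsFCFamily Fc := by
  have key : ∀ m < 7, 2 ≤ m → ((coreFours.take m).toFinset.card = m ∧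
      (∀ A ∈ (coreFours.take m).toFinset, A.card = 4) ∧
      ((coreFours.take m).toFinset.biUnion id).card = 6 ∧
      (coreFours.take m).toFinset ⊆ coreSets) := by decide +kernel
  obtain ⟨h, h', h'', hc⟩ := key m (by omega) h2
  exact ⟨_, h, h', h'', not_isFCFamily_of_subset_coreSets hc⟩

theorem mainTheorem3 :
    IsFCNumber 4 6 7 ∧
    ∀ m : ℕ, 2 ≤ m →
      ((∀ Fc : Finset (Finset ℕ), Fc.card = m → (∀ A ∈ Fc, A.card = 4) →
          (Fc.biUnion id).card = 6 → IsFCFamily Fc) ↔ 7 ≤ m) := by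
  refine ⟨⟨forcesFC_four_six_seven, fun m hm => ?_⟩, fun m h2 => ⟨fun h => ?_, fun hm Fc hc h4 hU =>
    forcesFC_four_six_seven Fc Fc subset_rfl h4 (hc ▸ hm) hU⟩⟩
  -- A family of six sets also has at least `m` sets for each `m < 7`, so one example refutes all of
  -- them, including `0` and `1`.
  · by_contra hlt
    obtain ⟨Fc, hc, h4, hU, hnot⟩ := exists_not_isFCFamily (m := 6) (by norm_num) le_rfl
    exact hnot (hm Fc Fc subset_rfl h4 (by omega) hU)
  · by_contra hlt
    obtain ⟨Fc, hc, h4, hU, hnot⟩ := exists_not_isFCFamily h2 (by omega)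
    exact hnot (h Fc hc h4 hU)
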